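/- For $0<r<\frac13$ let $S_j(x)=rx+\frac{j-1}{2}(1-r)$, $1\le j\le 3$, and let $P$ be the Borel probability measure on $\mathbb R$ with $P=\frac13\sum_{j=1}^3 P\circ S_j^{-1}$. For $n\ge 1$ let $$V_n(P)=\inf\Big\{\int\min_{a\in\alpha}|x-a|^2\,dP(x)\;:\;\alpha\subset\mathbb R,\ 1\le\operatorname{card}(\alpha)\le n\Big\}$$ be the $n$th quantization error of $P$, and let $\beta=-\frac{\log 3}{\log r}$. Let $r_1=0.2317626315\ldots$ be the unique number $r\in(0,\frac13)$ with $$-\frac{3r^5+15r^4+6r^3-42r^2+31r-13}{240(r+1)}=-\frac{3r^7+15r^6+60r^5+66r^4+18r^3-324r^2+283r-121}{2184(r+1)}.$$ If $0<r\le r_1$, then the $\beta$-dimensional quantization coefficient $\lim_{n\to\infty}n^{2/\beta}V_n(P)$ of $P$ does not exist. More precisely, the two subsequences of $\big(n^{2/\beta}V_n(P)\big)_{n\ge1}$ along $n=3^k$ and along $n=2\cdot3^k$ $(k\to\infty)$ converge to two different real limits. -/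

import Mathlib

open MeasureTheory Filter Topology

/-! ## Quantization of a Borel measure on the line -/

/-- The distortion error `V(P; α) = ∫ min_{a ∈ α} |x - a|² dP(x)` of a non-empty finite set `α`. -/
noncomputable def distortion (P : Measure ℝ) (α : Finset ℝ) (hα : α.Nonempty) : ℝ :=
  ∫ x, α.inf' hα (fun a => |x - a| ^ 2) ∂P

/-- The `n`-th quantization error `V_n(P)`: the infimum of the distortion errors over all
(non-empty) finite sets with at most `n` elements. -/
noncomputable def quantizationError (P : Measure ℝ) (n : ℕ) : ℝ :=
  sInf {v : ℝ | ∃ (α : Finset ℝ) (hα : α.Nonempty), α.card ≤ n ∧ v = distortion P α hα}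

/-- The sequence `n ↦ n^(2/s) V_n(P)`, whose limit, if it exists, is the `s`-dimensional
quantization coefficient of `P`. -/
noncomputable def quantizationSequence (P : Measure ℝ) (s : ℝ) (n : ℕ) : ℝ :=
  (n : ℝ) ^ (2 / s) * quantizationError P n

/-! ## The triadic Cantor distribution -/

/-- The three similarities `x ↦ r x + (j - 1)(1 - r)/2`, `j = 1, 2, 3`; here `j - 1` is the index
in `Fin 3`. -/
noncomputable def triadicMap (r : ℝ) (j : Fin 3) (x : ℝ) : ℝ :=
  r * x + ((j : ℕ) : ℝ) / 2 * (1 - r)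

/-- `P` is the triadic Cantor distribution with ratio `r`: a Borel probability measure with
`P = ∑ j, (1/3) P ∘ S_j⁻¹`. -/
structure IsTriadicCantorDistribution (r : ℝ) (P : Measure ℝ) : Prop where
  isProbabilityMeasure : IsProbabilityMeasure P
  selfSimilar : P = ∑ j : Fin 3, (3 : ENNReal)⁻¹ • P.map (triadicMap r j)

/-- The dimension `β = - log 3 / log r`. -/
noncomputable def triadicDim (r : ℝ) : ℝ := -Real.log 3 / Real.log r

/-! ### Existence of the triadic Cantor distribution -/

/-- The uniform distribution on the three-letter alphabet. -/
noncomputable def letterMeasure : Measure (Fin 3) :=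
  ∑ j : Fin 3, (3 : ENNReal)⁻¹ • Measure.dirac j

instance : IsProbabilityMeasure letterMeasure where
  measure_univ := by
    simp [letterMeasure, ENNReal.mul_inv_cancel]

/-- The uniform distribution on infinite words. -/
noncomputable def wordMeasure : Measure (ℕ → Fin 3) :=
  Measure.infinitePi (fun _ => letterMeasure)

instance : IsProbabilityMeasure wordMeasure := by
  unfold wordMeasure; infer_instance

/-- Prepend a letter to an infinite word. -/
def consWord (j : Fin 3) (w : ℕ → Fin 3) : ℕ → Fin 3
  | 0 => j
  | n + 1 => w n

theorem measurable_consWord (j : Fin 3) : Measurable (consWord j) := by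
  refine measurable_pi_lambda _ fun n => ?_
  cases n with
  | zero => exact measurable_const
  | succ n => exact measurable_pi_apply n

theorem wordMeasure_eq :
    wordMeasure = ∑ j : Fin 3, (3 : ENNReal)⁻¹ • wordMeasure.map (consWord j) := by
  symm
  refine Measure.eq_infinitePi _ fun s t ht => ?_
  classical
  set t' : ℕ → Set (Fin 3) := fun i => if i ∈ s then t i else Set.univ with ht'
  obtain ⟨N, hN⟩ : ∃ N, s ⊆ Finset.range (N + 1) :=
    ⟨s.sup id, fun i hi => by
      have : i ≤ s.sup id := Finset.le_sup (f := id) hi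
      simpa using Nat.lt_succ_of_le this⟩
  have hset : Set.pi (s : Set ℕ) t = Set.pi (Finset.range (N + 1) : Set ℕ) t' := by
    ext w
    simp only [Set.mem_pi, Finset.mem_coe, ht']
    constructor
    · intro h i _
      by_cases hi : i ∈ s
      · simpa [hi] using h i hi
      · simp [hi]
    · intro h i hi
      simpa [hi] using h i (hN hi)
  have hprod : ∏ i ∈ s, letterMeasure (t i) = ∏ i ∈ Finset.range (N + 1), letterMeasure (t' i) := by
    rw [← Finset.prod_subset hN]
    · refine Finset.prod_congr rfl fun i hi => ?_
      simp [ht', hi]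
    · intro i _ hi
      simp [ht', hi]
  have hm : ∀ A : Set (Fin 3), MeasurableSet A := fun A => A.toFinite.measurableSet
  have hpre : ∀ j, wordMeasure.map (consWord j) (Set.pi (Finset.range (N + 1) : Set ℕ) t')
      = (Measure.dirac j (t' 0)) * ∏ i ∈ Finset.range N, letterMeasure (t' (i + 1)) := by
    intro j
    rw [Measure.map_apply (measurable_consWord j)
      (MeasurableSet.pi (Finset.countable_toSet _) fun i _ => hm _)]
    by_cases hj : j ∈ t' 0
    · have : consWord j ⁻¹' (Set.pi (Finset.range (N + 1) : Set ℕ) t')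
          = Set.pi (Finset.range N : Set ℕ) (fun i => t' (i + 1)) := by
        ext w
        simp only [Set.mem_preimage, Set.mem_pi, Finset.mem_coe, Finset.mem_range]
        constructor
        · intro h i hi
          exact h (i + 1) (by omega)
        · intro h i hi
          cases i with
          | zero => exact hj
          | succ i => exact h i (by omega)
      rw [this, wordMeasure, Measure.infinitePi_pi _ (fun i _ => hm _),
        Measure.dirac_apply' _ (hm _)]
      simp [hj]
    · have : consWord j ⁻¹' (Set.pi (Finset.range (N + 1) : Set ℕ) t') = ∅ := by
        ext w
        simp only [Set.mem_preimage, Set.mem_pi, Finset.mem_coe, Finset.mem_range,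
          Set.mem_empty_iff_false, iff_false]
        intro h
        exact hj (h 0 (by omega))
      rw [this, Measure.dirac_apply' _ (hm _)]
      simp [hj]
  rw [hset, hprod, Finset.prod_range_succ']
  simp only [Measure.coe_finsetSum, Finset.sum_apply, Measure.smul_apply, hpre, smul_eq_mul]
  rw [mul_comm, letterMeasure]
  simp only [Measure.coe_finsetSum, Finset.sum_apply, Measure.smul_apply, smul_eq_mul]
  rw [Finset.sum_mul]
  exact Finset.sum_congr rfl fun j _ => by rw [mul_assoc]

/-- The point of the Cantor set coded by an infinite word. -/
noncomputable def codeWord (r : ℝ) (w : ℕ → Fin 3) : ℝ :=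
  ∑' n : ℕ, r ^ n * (((w n : ℕ) : ℝ) / 2 * (1 - r))

theorem codeWord_bound {r : ℝ} (h0 : 0 < r) (h1 : r < 1) (n : ℕ) (w : ℕ → Fin 3) :
    ‖r ^ n * (((w n : ℕ) : ℝ) / 2 * (1 - r))‖ ≤ r ^ n := by
  have hw : ((w n : ℕ) : ℝ) ≤ 2 := by exact_mod_cast Nat.lt_succ_iff.mp (w n).isLt
  have hw0 : (0 : ℝ) ≤ ((w n : ℕ) : ℝ) := Nat.cast_nonneg _
  have hp : 0 < r ^ n := pow_pos h0 n
  have h2 : 0 ≤ ((w n : ℕ) : ℝ) / 2 * (1 - r) := mul_nonneg (by linarith) (by linarith)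
  rw [Real.norm_of_nonneg (mul_nonneg hp.le h2)]
  have : ((w n : ℕ) : ℝ) / 2 * (1 - r) ≤ 1 := by nlinarith
  nlinarith

theorem measurable_codeWord {r : ℝ} (h0 : 0 < r) (h1 : r < 1) : Measurable (codeWord r) := by
  have : Continuous (codeWord r) := by
    refine continuous_tsum (fun n => ?_) (summable_geometric_of_lt_one h0.le h1)
      (fun n w => codeWord_bound h0 h1 n w)
    have : Continuous (fun j : Fin 3 => r ^ n * (((j : ℕ) : ℝ) / 2 * (1 - r))) :=
      continuous_of_discreteTopology
    exact this.comp (continuous_apply n)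
  exact this.measurable

theorem codeWord_consWord {r : ℝ} (h0 : 0 < r) (h1 : r < 1) (j : Fin 3) (w : ℕ → Fin 3) :
    codeWord r (consWord j w) = triadicMap r j (codeWord r w) := by
  have hs : ∀ v : ℕ → Fin 3, Summable fun n : ℕ => r ^ n * (((v n : ℕ) : ℝ) / 2 * (1 - r)) :=
    fun v => Summable.of_norm_bounded (summable_geometric_of_lt_one h0.le h1)
      (fun n => codeWord_bound h0 h1 n v)
  unfold codeWord triadicMap
  rw [(hs (consWord j w)).tsum_eq_zero_add, ← tsum_mul_left]
  simp only [consWord, pow_zero, one_mul, pow_succ]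
  rw [add_comm]
  congr 1
  exact tsum_congr fun n => by ring

theorem measurable_triadicMap (r : ℝ) (j : Fin 3) : Measurable (triadicMap r j) := by
  unfold triadicMap; fun_prop

/-- For every ratio a triadic Cantor distribution exists. -/
theorem exists_isTriadicCantorDistribution {r : ℝ} (h0 : 0 < r) (h1 : r < 1) :
    ∃ P : Measure ℝ, IsTriadicCantorDistribution r P := by
  have hc := measurable_codeWord h0 h1
  refine ⟨wordMeasure.map (codeWord r), Measure.isProbabilityMeasure_map hc.aemeasurable, ?_⟩
  conv_lhs => rw [wordMeasure_eq]
  have key : ∀ j, (wordMeasure.map (consWord j)).map (codeWord r)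
      = (wordMeasure.map (codeWord r)).map (triadicMap r j) := by
    intro j
    rw [Measure.map_map hc (measurable_consWord j), Measure.map_map (measurable_triadicMap r j) hc]
    congr 1
    funext w
    exact codeWord_consWord h0 h1 j w
  rw [← Measure.mapₗ_apply_of_measurable hc, map_sum]
  refine Finset.sum_congr rfl fun j _ => ?_
  rw [map_smul, Measure.mapₗ_apply_of_measurable hc, key]

/-! ## The critical ratio `r₁` -/

/-- The equation that determines the critical ratio in `(0, 1/3)`. -/
def IsCriticalRatio (r : ℝ) : Prop :=
  r ∈ Set.Ioo (0 : ℝ) (1 / 3) ∧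
    -(3 * r ^ 5 + 15 * r ^ 4 + 6 * r ^ 3 - 42 * r ^ 2 + 31 * r - 13) / (240 * (r + 1)) =
      -(3 * r ^ 7 + 15 * r ^ 6 + 60 * r ^ 5 + 66 * r ^ 4 + 18 * r ^ 3 - 324 * r ^ 2
        + 283 * r - 121) / (2184 * (r + 1))

theorem existsUnique_isCriticalRatio : ∃! r : ℝ, IsCriticalRatio r := by
  set f : ℝ → ℝ := fun r =>
    2184 * (3 * r ^ 5 + 15 * r ^ 4 + 6 * r ^ 3 - 42 * r ^ 2 + 31 * r - 13)
      - 240 * (3 * r ^ 7 + 15 * r ^ 6 + 60 * r ^ 5 + 66 * r ^ 4 + 18 * r ^ 3 - 324 * r ^ 2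
        + 283 * r - 121) with hf
  have hiff : ∀ r : ℝ, IsCriticalRatio r ↔ r ∈ Set.Ioo (0 : ℝ) (1 / 3) ∧ f r = 0 := by
    intro r
    refine and_congr_right fun hr => ?_
    have h : r + 1 ≠ 0 := by linarith [hr.1]
    rw [div_eq_div_iff (by positivity) (by positivity)]
    constructor
    · intro e
      have : (r + 1) * f r = 0 := by simp only [hf]; linear_combination -e
      exact (mul_eq_zero.mp this).resolve_left h
    · intro e
      simp only [hf] at e
      linear_combination -(r + 1) * e
  have hcont : Continuous f := by simp only [hf]; fun_prop
  have hanti : ∀ x y : ℝ, 0 < x → x < y → y < 1 / 3 → f y < f x := by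
    intro x y hx hxy hy
    have h0 : 0 < y := hx.trans hxy
    have h2 : 0 < y ^ 2 - x ^ 2 := by nlinarith
    have h3 : y ^ 3 - x ^ 3 ≤ 2 / 3 * (y ^ 2 - x ^ 2) := by
      have : 0 ≤ (y - x) * (2 / 3 * (y + x) - (y ^ 2 + x * y + x ^ 2)) :=
        mul_nonneg (by linarith) (by nlinarith)
      linarith
    have h4 : y ^ 4 - x ^ 4 ≤ 2 / 9 * (y ^ 2 - x ^ 2) := by
      have : 0 ≤ (y ^ 2 - x ^ 2) * (2 / 9 - (y ^ 2 + x ^ 2)) :=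
        mul_nonneg h2.le (by nlinarith)
      linarith
    have h5 : x ^ 5 ≤ y ^ 5 := pow_le_pow_left₀ hx.le hxy.le 5
    have h6 : x ^ 6 ≤ y ^ 6 := pow_le_pow_left₀ hx.le hxy.le 6
    have h7 : x ^ 7 ≤ y ^ 7 := pow_le_pow_left₀ hx.le hxy.le 7
    simp only [hf]
    linarith
  have hex : ∃ r ∈ Set.Ioo (0 : ℝ) (1 / 3), f r = 0 := by
    have := intermediate_value_Ioo' (by norm_num : (0 : ℝ) ≤ 1 / 3) hcont.continuousOn
    exact this ⟨by simp only [hf]; norm_num, by simp only [hf]; norm_num⟩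
  obtain ⟨r, hr, e⟩ := hex
  refine ⟨r, (hiff r).2 ⟨hr, e⟩, fun y hy => ?_⟩
  obtain ⟨hy, ey⟩ := (hiff y).1 hy
  rcases lt_trichotomy y r with h | h | h
  · have := hanti y r hy.1 h hr.2
    linarith
  · exact h
  · have := hanti r y hr.1 h hy.2
    linarith

/-- The critical ratio `r₁ = 0.2317626315…`, the unique solution in `(0, 1/3)`. -/
noncomputable def criticalRatio : ℝ := existsUnique_isCriticalRatio.choose

/-!
# Non-existence of the quantization coefficient of the triadic Cantor distribution

Applying the three similarities to a set of `n` centres gives `V_{3n} ≤ r² V_n`. Since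
`(3 ^ k) ^ (2 / β) = r ^ (-2k)`, the sequence `n ^ (2 / β) V_n` is therefore antitone and nonnegative
along `n = m * 3 ^ k` for each `m ≥ 1`, so it converges there. It remains to separate the limits `a`
for `m = 1` and `b` for `m = 2`; the optimal sets and the exact errors are not needed.

* Upper bound for `a`: it is at most `V_1`, hence at most the variance `(1 - r) / (6 (1 + r))`.
* Lower bound for `b`: `P` is an average over `y ~ P` of uniform distributions on the `3 ^ (k + 1)`
  points `r ^ (k + 1) y + c`, with `c` a left endpoint of a cylinder of level `k + 1`. For `r ≤ 1 / 3`
  these points have mutual distances at least `D = r ^ k (1 - r) / 2`. A centre that serves `m` of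
  them costs at least `(m - 1) D² / 2`, so `2 * 3 ^ k` centres cost at least `3 ^ k D² / 2`
  (`card_sub_card_mul_le_sum_inf'`). Hence `r ^ (-2k) V_{2 * 3 ^ k} ≥ (1 - r)² / 24`
  (`IsTriadicCantorDistribution.le_quantizationError_two_mul`), and `2 ^ (2 / β) ≥ 1 / r` because
  `4 ≥ 3`, so `b ≥ (1 - r)² / (24 r)`.

The lower bound for `b` exceeds the upper bound for `a` as soon as `4 r < 1 - r²`, i.e.
`r < √5 - 2 = 0.236…`, and the critical ratio is less than `0.235`.
-/

/-! ### Separated points and a pigeonhole bound for the distortion -/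

theorem card_sub_one_mul_le_sum_sq {ι : Type*} [DecidableEq ι] (s : Finset ι) (p : ι → ℝ) (a : ℝ)
    {D : ℝ} (hD : 0 ≤ D) (hsep : ∀ i ∈ s, ∀ j ∈ s, i ≠ j → D ≤ |p i - p j|) :
    ((s.card : ℝ) - 1) * (D ^ 2 / 2) ≤ ∑ i ∈ s, |p i - a| ^ 2 := by
  rcases s.eq_empty_or_nonempty with rfl | hs
  · simp only [Finset.card_empty, Finset.sum_empty, Nat.cast_zero]
    nlinarith [sq_nonneg D]
  have hpos : (0 : ℝ) < s.card := by exact_mod_cast hs.card_pos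
  -- The double sum of `(p i - p j)²` equals `2 * #s * ∑ (p i - a)² - 2 * (∑ (p i - a))²`.
  have hdouble : ∑ i ∈ s, ∑ j ∈ s, (p i - p j) ^ 2
      = 2 * s.card * ∑ i ∈ s, (p i - a) ^ 2 - 2 * (∑ i ∈ s, (p i - a)) ^ 2 := by
    have h : ∀ i j, (p i - p j) ^ 2
        = (p i - a) ^ 2 + (p j - a) ^ 2 - 2 * ((p i - a) * (p j - a)) := fun i j => by ring
    simp only [h, Finset.sum_sub_distrib, Finset.sum_add_distrib, Finset.sum_const, nsmul_eq_mul,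
      ← Finset.mul_sum, ← Finset.sum_mul]
    ring
  have hlow : (s.card : ℝ) * (((s.card : ℝ) - 1) * D ^ 2)
      ≤ ∑ i ∈ s, ∑ j ∈ s, (p i - p j) ^ 2 := by
    rw [← nsmul_eq_mul]
    refine Finset.card_nsmul_le_sum _ _ _ fun i hi => ?_
    rw [← Finset.add_sum_erase s _ hi, ← Nat.cast_pred hs.card_pos, ← Finset.card_erase_of_mem hi,
      ← nsmul_eq_mul]
    have := Finset.card_nsmul_le_sum (s.erase i) (fun j => (p i - p j) ^ 2) (D ^ 2) fun j hj => by
      rw [← sq_abs (p i - p j)]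
      exact pow_le_pow_left₀ hD
        (hsep i hi j (Finset.mem_of_mem_erase hj) (Finset.ne_of_mem_erase hj).symm) 2
    simpa using this
  simp only [sq_abs]
  refine le_of_mul_le_mul_left ?_ hpos
  nlinarith [sq_nonneg (∑ i ∈ s, (p i - a))]

/-- If `#s` points are `D`-separated and `#α` centres serve them, each centre serving `m ≥ 1` points
costs at least `(m - 1) D² / 2`; summing over the centres gives the bound. -/
theorem card_sub_card_mul_le_sum_inf' {ι : Type*} [DecidableEq ι] (s : Finset ι) (p : ι → ℝ)
    (α : Finset ℝ) (hα : α.Nonempty) {D : ℝ} (hD : 0 ≤ D)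
    (hsep : ∀ i ∈ s, ∀ j ∈ s, i ≠ j → D ≤ |p i - p j|) :
    ((s.card : ℝ) - α.card) * (D ^ 2 / 2) ≤ ∑ i ∈ s, α.inf' hα (fun a => |p i - a| ^ 2) := by
  choose T hTmem hT using fun i => Finset.exists_mem_eq_inf' hα (fun a => |p i - a| ^ 2)
  have hmaps : ∀ i ∈ s, T i ∈ α := fun i _ => hTmem i
  rw [← Finset.sum_fiberwise_of_maps_to hmaps]
  have hcard : (s.card : ℝ) = ∑ a ∈ α, ((s.filter fun i => T i = a).card : ℝ) := by
    exact_mod_cast Finset.card_eq_sum_card_fiberwise hmaps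
  have hα1 : (α.card : ℝ) = ∑ _a ∈ α, (1 : ℝ) := by simp
  rw [hcard, hα1, ← Finset.sum_sub_distrib, Finset.sum_mul]
  refine Finset.sum_le_sum fun a _ => ?_
  refine (card_sub_one_mul_le_sum_sq (s.filter fun i => T i = a) p a hD fun i hi j hj hij =>
    hsep i (Finset.mem_filter.1 hi).1 j (Finset.mem_filter.1 hj).1 hij).trans
    (Finset.sum_le_sum fun i hi => ?_)
  rw [hT i, (Finset.mem_filter.1 hi).2]

/-! ### Boundedness of the support and integration against the self-similar measure -/

theorem abs_triadicMap_sub_half_le {r : ℝ} (h0 : 0 < r) (h1 : r < 1) (j : Fin 3) (x : ℝ) :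
    |triadicMap r j x - 1 / 2| ≤ r * |x - 1 / 2| + (1 - r) / 2 := by
  have hj : |((j : ℕ) : ℝ) - 1| ≤ 1 := by fin_cases j <;> norm_num
  have e : triadicMap r j x - 1 / 2 = r * (x - 1 / 2) + (((j : ℕ) : ℝ) - 1) * ((1 - r) / 2) := by
    unfold triadicMap; ring
  rw [e]
  refine (abs_add_le _ _).trans ?_
  rw [abs_mul, abs_mul, abs_of_pos h0, abs_of_pos (by linarith : 0 < (1 - r) / 2)]
  nlinarith

namespace IsTriadicCantorDistribution

variable {r : ℝ} {P : Measure ℝ}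

/-- One application of the self-similarity replaces the tail beyond distance `1 / 2 + e` from the
centre by the tail beyond `1 / 2 + e / r`; iterating it makes the tail vanish. -/
theorem measure_tail_le (hP : IsTriadicCantorDistribution r P) (h0 : 0 < r) (h1 : r < 1) (e : ℝ) :
    P {x | 1 / 2 + e < |x - 1 / 2|} ≤ P {x | 1 / 2 + e / r < |x - 1 / 2|} := by
  have hm : MeasurableSet {x : ℝ | 1 / 2 + e < |x - 1 / 2|} :=
    measurableSet_lt measurable_const (by fun_prop)
  conv_lhs => rw [hP.selfSimilar]
  simp only [Measure.coe_finsetSum, Finset.sum_apply, Measure.smul_apply, smul_eq_mul]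
  calc ∑ j : Fin 3, (3 : ENNReal)⁻¹ * P.map (triadicMap r j) {x | 1 / 2 + e < |x - 1 / 2|}
      ≤ ∑ _j : Fin 3, (3 : ENNReal)⁻¹ * P {x | 1 / 2 + e / r < |x - 1 / 2|} := by
        refine Finset.sum_le_sum fun j _ => mul_le_mul_right ?_ _
        rw [Measure.map_apply (measurable_triadicMap r j) hm]
        refine measure_mono fun x hx => ?_
        simp only [Set.mem_preimage, Set.mem_ofPred_eq] at hx ⊢
        have := abs_triadicMap_sub_half_le h0 h1 j x
        have h2 : e / r < |x - 1 / 2| - 1 / 2 := by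
          rw [div_lt_iff₀ h0]
          nlinarith
        linarith
    _ = P {x | 1 / 2 + e / r < |x - 1 / 2|} := by
        rw [Finset.sum_const, Finset.card_univ, Fintype.card_fin, nsmul_eq_mul, ← mul_assoc,
          Nat.cast_ofNat, ENNReal.mul_inv_cancel (by simp) (by simp), one_mul]

theorem ae_mem_Icc (hP : IsTriadicCantorDistribution r P) (h0 : 0 < r) (h1 : r < 1) :
    ∀ᵐ x ∂P, x ∈ Set.Icc (-1 / 2 : ℝ) (3 / 2) := by
  have := hP.isProbabilityMeasure
  have hiter : ∀ n : ℕ, P {x | 1 / 2 + 1 / 2 < |x - 1 / 2|}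
      ≤ P {x | 1 / 2 + 1 / 2 / r ^ n < |x - 1 / 2|} := by
    intro n
    induction n with
    | zero => simp
    | succ n ih =>
      refine ih.trans ((hP.measure_tail_le h0 h1 _).trans_eq ?_)
      rw [div_div, ← pow_succ]
  have hanti : Antitone fun n : ℕ => {x : ℝ | 1 / 2 + 1 / 2 / r ^ n < |x - 1 / 2|} := by
    intro m n hmn x hx
    simp only [Set.mem_ofPred_eq] at hx ⊢
    have : 1 / 2 / r ^ m ≤ 1 / 2 / r ^ n :=
      div_le_div_of_nonneg_left (by norm_num) (pow_pos h0 n)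
        (pow_le_pow_of_le_one h0.le h1.le hmn)
    linarith
  have hempty : ⋂ n : ℕ, {x : ℝ | 1 / 2 + 1 / 2 / r ^ n < |x - 1 / 2|} = ∅ := by
    refine Set.eq_empty_of_forall_notMem fun x hx => ?_
    obtain ⟨n, hn⟩ := pow_unbounded_of_one_lt (2 * |x - 1 / 2|) ((one_lt_inv₀ h0).2 h1)
    have := Set.mem_iInter.1 hx n
    simp only [Set.mem_ofPred_eq, div_eq_mul_inv] at this
    rw [inv_pow] at hn
    simp only [div_eq_mul_inv] at hn
    linarith
  have hlim := tendsto_measure_iInter_atTop (μ := P)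
    (fun n => (measurableSet_lt measurable_const (by fun_prop) :
      MeasurableSet {x : ℝ | 1 / 2 + 1 / 2 / r ^ n < |x - 1 / 2|}).nullMeasurableSet)
    hanti ⟨0, measure_ne_top P _⟩
  rw [hempty, measure_empty] at hlim
  have hzero : P {x | 1 / 2 + 1 / 2 < |x - 1 / 2|} = 0 :=
    le_antisymm (ge_of_tendsto' hlim hiter) zero_le
  have hae : ∀ᵐ x ∂P, ¬ (1 / 2 + 1 / 2 < |x - 1 / 2|) := by
    rw [ae_iff]; simpa using hzero
  filter_upwards [hae] with x hx
  have := abs_le.1 (not_lt.1 hx)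
  exact ⟨by linarith [this.1], by linarith [this.2]⟩

theorem integrable (hP : IsTriadicCantorDistribution r P) (h0 : 0 < r) (h1 : r < 1) {f : ℝ → ℝ}
    (hf : Continuous f) : Integrable f P := by
  have := hP.isProbabilityMeasure
  have h := hf.continuousOn.integrableOn_compact (μ := P) (isCompact_Icc (a := (-1 / 2 : ℝ))
    (b := 3 / 2))
  rwa [IntegrableOn, Measure.restrict_eq_self_of_ae_mem (hP.ae_mem_Icc h0 h1)] at h

theorem integral_eq (hP : IsTriadicCantorDistribution r P) (h0 : 0 < r) (h1 : r < 1) {f : ℝ → ℝ}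
    (hf : Continuous f) : ∫ x, f x ∂P = 3⁻¹ * ∑ j : Fin 3, ∫ x, f (triadicMap r j x) ∂P := by
  have hS : ∀ j, Continuous (triadicMap r j) := fun j => by unfold triadicMap; fun_prop
  conv_lhs => rw [hP.selfSimilar]
  rw [integral_finsetSum_measure, Finset.mul_sum]
  · refine Finset.sum_congr rfl fun j _ => ?_
    rw [integral_smul_measure, integral_map (measurable_triadicMap r j).aemeasurable
      hf.aestronglyMeasurable]
    simp
  · intro j _
    refine Integrable.smul_measure ?_ (by simp)
    exact (integrable_map_measure hf.aestronglyMeasurable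
      (measurable_triadicMap r j).aemeasurable).2 (hP.integrable h0 h1 (hf.comp (hS j)))

end IsTriadicCantorDistribution

/-! ### Left endpoints of the cylinder intervals -/

/-- The left endpoints of the `3 ^ k` cylinder intervals of level `k`, i.e. the images of `0` under
the `k`-fold compositions of the three similarities. -/
noncomputable def leftEndpoints (r : ℝ) : ℕ → Finset ℝ
  | 0 => {0}
  | k + 1 => Finset.univ.biUnion fun j : Fin 3 => (leftEndpoints r k).image (triadicMap r j)

theorem leftEndpoints_mem_Icc {r : ℝ} (h0 : 0 < r) (h1 : r < 1) (k : ℕ) :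
    ∀ c ∈ leftEndpoints r k, c ∈ Set.Icc 0 (1 - r ^ k) := by
  induction k with
  | zero => simp [leftEndpoints]
  | succ k ih =>
    intro c hc
    simp only [leftEndpoints, Finset.mem_biUnion, Finset.mem_univ, true_and, Finset.mem_image] at hc
    obtain ⟨j, c, hc, rfl⟩ := hc
    obtain ⟨hc0, hc1⟩ := ih c hc
    have hj : (0 : ℝ) ≤ ((j : ℕ) : ℝ) ∧ ((j : ℕ) : ℝ) ≤ 2 := by fin_cases j <;> norm_num
    unfold triadicMap
    rw [pow_succ]
    constructor
    · have : 0 ≤ ((j : ℕ) : ℝ) / 2 * (1 - r) := mul_nonneg (by linarith) (by linarith)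
      nlinarith
    · nlinarith

/-- Left endpoints of level `k` lie in `[0, 1 - r ^ k]`, not just in `[0, 1]`; for `k = 0` only this
sharper range gives the full distance `(1 - r) / 2` between the images. -/
theorem le_abs_triadicMap_sub {r : ℝ} (h0 : 0 < r) (h1 : r ≤ 1 / 3) {k : ℕ} {i j : Fin 3}
    (hij : i ≠ j) {c d : ℝ} (hc : c ∈ leftEndpoints r k) (hd : d ∈ leftEndpoints r k) :
    r ^ k * ((1 - r) / 2) ≤ |triadicMap r i c - triadicMap r j d| := by
  obtain ⟨hc0, hc1⟩ := leftEndpoints_mem_Icc h0 (by linarith) k c hc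
  obtain ⟨hd0, hd1⟩ := leftEndpoints_mem_Icc h0 (by linarith) k d hd
  have hk : r ^ k ≤ 1 := pow_le_one₀ h0.le (by linarith)
  have hkey : r ^ k * ((1 - r) / 2) ≤ (1 - r) / 2 - r * (1 - r ^ k) := by nlinarith
  have hdist : ∀ i j : Fin 3, i < j → ∀ c d : ℝ, c ≤ 1 - r ^ k → 0 ≤ d →
      r ^ k * ((1 - r) / 2) ≤ triadicMap r j d - triadicMap r i c := by
    intro i j hij c d hc hd
    have hij' : ((i : ℕ) : ℝ) + 1 ≤ ((j : ℕ) : ℝ) := by exact_mod_cast Nat.succ_le_of_lt hij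
    unfold triadicMap
    nlinarith [mul_le_mul_of_nonneg_left hc h0.le, mul_nonneg h0.le hd]
  rcases lt_or_gt_of_ne hij with h | h
  · rw [abs_sub_comm]
    exact (hdist i j h c d hc1 hd0).trans (le_abs_self _)
  · exact (hdist j i h d c hd1 hc0).trans (le_abs_self _)

theorem leftEndpoints_separated {r : ℝ} (h0 : 0 < r) (h1 : r ≤ 1 / 3) (k : ℕ) :
    ∀ c ∈ leftEndpoints r k, ∀ d ∈ leftEndpoints r k, c ≠ d →
      r ^ k * ((1 - r) / 2) ≤ r * |c - d| := by
  induction k with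
  | zero =>
    intro c hc d hd hcd
    simp only [leftEndpoints, Finset.mem_singleton] at hc hd
    exact absurd (hc.trans hd.symm) hcd
  | succ k ih =>
    intro c hc d hd hcd
    simp only [leftEndpoints, Finset.mem_biUnion, Finset.mem_univ, true_and, Finset.mem_image]
      at hc hd
    obtain ⟨i, c, hc, rfl⟩ := hc
    obtain ⟨j, d, hd, rfl⟩ := hd
    rw [pow_succ', mul_assoc]
    refine mul_le_mul_of_nonneg_left ?_ h0.le
    by_cases hij : i = j
    · subst hij
      have e : triadicMap r i c - triadicMap r i d = r * (c - d) := by unfold triadicMap; ring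
      rw [e, abs_mul, abs_of_pos h0]
      exact ih c hc d hd fun h => hcd (h ▸ rfl)
    · exact le_abs_triadicMap_sub h0 h1 hij hc hd

theorem sum_leftEndpoints_succ {r : ℝ} (h0 : 0 < r) (h1 : r ≤ 1 / 3) (k : ℕ) {M : Type*}
    [AddCommMonoid M] (g : ℝ → M) :
    ∑ c ∈ leftEndpoints r (k + 1), g c
      = ∑ j : Fin 3, ∑ c ∈ leftEndpoints r k, g (triadicMap r j c) := by
  rw [leftEndpoints, Finset.sum_biUnion]
  · refine Finset.sum_congr rfl fun j _ => Finset.sum_image fun c _ d _ h => ?_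
    unfold triadicMap at h
    exact mul_left_cancel₀ h0.ne' (add_right_cancel h)
  · intro i _ j _ hij
    refine Finset.disjoint_left.2 fun x hx hy => ?_
    obtain ⟨c, hc, rfl⟩ := Finset.mem_image.1 hx
    obtain ⟨d, hd, h⟩ := Finset.mem_image.1 hy
    have := le_abs_triadicMap_sub h0 h1 hij hc hd
    rw [h, sub_self, abs_zero] at this
    have : 0 < r ^ k * ((1 - r) / 2) := mul_pos (pow_pos h0 k) (by linarith)
    linarith

theorem card_leftEndpoints {r : ℝ} (h0 : 0 < r) (h1 : r ≤ 1 / 3) (k : ℕ) :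
    (leftEndpoints r k).card = 3 ^ k := by
  induction k with
  | zero => simp [leftEndpoints]
  | succ k ih =>
    rw [Finset.card_eq_sum_ones, sum_leftEndpoints_succ h0 h1]
    simp [ih, pow_succ']

/-! ### Bounds for the quantization errors -/

theorem continuous_inf'_sq_dist (α : Finset ℝ) (hα : α.Nonempty) :
    Continuous fun x : ℝ => α.inf' hα (fun a => |x - a| ^ 2) :=
  Continuous.finset_inf'_apply hα fun a _ => by fun_prop

theorem inf'_sq_dist_nonneg (α : Finset ℝ) (hα : α.Nonempty) (x : ℝ) :
    0 ≤ α.inf' hα (fun a => |x - a| ^ 2) :=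
  Finset.le_inf' _ _ fun a _ => by positivity

theorem distortion_nonneg (P : Measure ℝ) (α : Finset ℝ) (hα : α.Nonempty) :
    0 ≤ distortion P α hα :=
  integral_nonneg fun x => inf'_sq_dist_nonneg α hα x

theorem quantizationError_le_distortion (P : Measure ℝ) {n : ℕ} (α : Finset ℝ) (hα : α.Nonempty)
    (hn : α.card ≤ n) : quantizationError P n ≤ distortion P α hα :=
  csInf_le ⟨0, fun _ ⟨β, hβ, _, hv⟩ => hv ▸ distortion_nonneg P β hβ⟩ ⟨α, hα, hn, rfl⟩

theorem le_quantizationError (P : Measure ℝ) {n : ℕ} (hn : 1 ≤ n) {b : ℝ}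
    (h : ∀ (α : Finset ℝ) (hα : α.Nonempty), α.card ≤ n → b ≤ distortion P α hα) :
    b ≤ quantizationError P n :=
  le_csInf ⟨_, {0}, Finset.singleton_nonempty 0, by simpa using hn, rfl⟩
    fun _ ⟨α, hα, hc, hv⟩ => hv ▸ h α hα hc

theorem quantizationError_nonneg (P : Measure ℝ) (n : ℕ) : 0 ≤ quantizationError P n :=
  Real.sInf_nonneg fun _ ⟨α, hα, _, hv⟩ => hv ▸ distortion_nonneg P α hα

namespace IsTriadicCantorDistribution

variable {r : ℝ} {P : Measure ℝ}

theorem integral_eq_sum_leftEndpoints (hP : IsTriadicCantorDistribution r P) (h0 : 0 < r)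
    (h1 : r ≤ 1 / 3) (k : ℕ) {f : ℝ → ℝ} (hf : Continuous f) :
    ∫ x, f x ∂P = (3 ^ k)⁻¹ * ∑ c ∈ leftEndpoints r k, ∫ x, f (r ^ k * x + c) ∂P := by
  induction k generalizing f with
  | zero => simp [leftEndpoints]
  | succ k ih =>
    have hS : ∀ j, Continuous (triadicMap r j) := fun j => by unfold triadicMap; fun_prop
    rw [hP.integral_eq h0 (by linarith) hf, sum_leftEndpoints_succ h0 h1, pow_succ, mul_inv,
      mul_comm (3 ^ k : ℝ)⁻¹, mul_assoc, Finset.mul_sum _ _ (3 ^ k : ℝ)⁻¹]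
    congr 1
    refine Finset.sum_congr rfl fun j _ => ?_
    rw [ih (f := fun x => f (triadicMap r j x)) (hf.comp (hS j))]
    congr 1
    refine Finset.sum_congr rfl fun c _ => integral_congr_ae (.of_forall fun x => ?_)
    simp only [triadicMap]
    congr 1
    ring

/-- With at most `2 * 3 ^ k` centres, the `3 ^ (k + 1)` points `r ^ (k + 1) * y + c` leave an excess
of at least `3 ^ k` points, for every `y`. -/
theorem le_quantizationError_two_mul (hP : IsTriadicCantorDistribution r P) (h0 : 0 < r)
    (h1 : r ≤ 1 / 3) (k : ℕ) :
    r ^ (2 * k) * ((1 - r) ^ 2 / 24) ≤ quantizationError P (2 * 3 ^ k) := by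
  have := hP.isProbabilityMeasure
  refine le_quantizationError P (by have := Nat.one_le_pow k 3 (by norm_num); omega)
    fun α hα hc => ?_
  have hcont := continuous_inf'_sq_dist α hα
  have hint : ∀ c, Integrable (fun y => α.inf' hα (fun a => |r ^ (k + 1) * y + c - a| ^ 2)) P :=
    fun c => hP.integrable h0 (by linarith) (hcont.comp (by fun_prop :
      Continuous fun y : ℝ => r ^ (k + 1) * y + c))
  rw [distortion, hP.integral_eq_sum_leftEndpoints h0 h1 (k + 1) hcont,
    ← integral_finsetSum _ fun c _ => hint c]
  have hcR : (α.card : ℝ) ≤ 2 * 3 ^ k := by exact_mod_cast hc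
  have hD : 0 ≤ r ^ k * ((1 - r) / 2) := mul_nonneg (pow_nonneg h0.le k) (by linarith)
  have hlow : ∀ y : ℝ, 3 ^ k * ((r ^ k * ((1 - r) / 2)) ^ 2 / 2)
      ≤ ∑ c ∈ leftEndpoints r (k + 1), α.inf' hα (fun a => |r ^ (k + 1) * y + c - a| ^ 2) := by
    intro y
    refine le_trans ?_ (card_sub_card_mul_le_sum_inf' (leftEndpoints r (k + 1))
      (fun c => r ^ (k + 1) * y + c) α hα hD fun c hc d hd hcd => ?_)
    · rw [card_leftEndpoints h0 h1]
      refine mul_le_mul_of_nonneg_right ?_ (by positivity)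
      push_cast
      rw [pow_succ]
      linarith
    · have := leftEndpoints_separated h0 h1 (k + 1) c hc d hd hcd
      rw [pow_succ', mul_assoc] at this
      rw [add_sub_add_left_eq_sub]
      exact le_of_mul_le_mul_left this h0
  have hmono : 3 ^ k * ((r ^ k * ((1 - r) / 2)) ^ 2 / 2) ≤
      ∫ y, ∑ c ∈ leftEndpoints r (k + 1), α.inf' hα (fun a => |r ^ (k + 1) * y + c - a| ^ 2) ∂P := by
    have h := integral_mono (integrable_const (μ := P) _)
      (integrable_finsetSum (leftEndpoints r (k + 1)) fun c _ => hint c) hlow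
    simpa only [integral_const, probReal_univ, one_smul] using h
  calc r ^ (2 * k) * ((1 - r) ^ 2 / 24)
      = (3 ^ (k + 1))⁻¹ * (3 ^ k * ((r ^ k * ((1 - r) / 2)) ^ 2 / 2)) := by
        rw [pow_succ, pow_mul']
        field_simp
        ring
    _ ≤ _ := mul_le_mul_of_nonneg_left hmono (by positivity)

theorem quantizationError_three_mul_le (hP : IsTriadicCantorDistribution r P) (h0 : 0 < r)
    (h1 : r < 1) {n : ℕ} (hn : 1 ≤ n) :
    quantizationError P (3 * n) ≤ r ^ 2 * quantizationError P n := by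
  rw [← div_le_iff₀' (by positivity)]
  refine le_quantizationError P hn fun α hα hc => ?_
  rw [div_le_iff₀' (by positivity)]
  have hmem : ∀ (j : Fin 3), ∀ a ∈ α,
      triadicMap r j a ∈ Finset.univ.biUnion fun j : Fin 3 => α.image (triadicMap r j) :=
    fun j a ha => Finset.mem_biUnion.2 ⟨j, Finset.mem_univ j, Finset.mem_image_of_mem _ ha⟩
  set β : Finset ℝ := Finset.univ.biUnion fun j : Fin 3 => α.image (triadicMap r j)
  obtain ⟨a₀, ha₀⟩ := hα
  have hβ : β.Nonempty := ⟨_, hmem 0 a₀ ha₀⟩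
  have hα : α.Nonempty := ⟨a₀, ha₀⟩
  have hcard : β.card ≤ 3 * n := by
    refine Finset.card_biUnion_le.trans ?_
    calc ∑ j : Fin 3, (α.image (triadicMap r j)).card ≤ ∑ _j : Fin 3, n :=
          Finset.sum_le_sum fun j _ => Finset.card_image_le.trans hc
      _ = 3 * n := by simp
  refine (quantizationError_le_distortion P β hβ hcard).trans ?_
  have hS : ∀ j, Continuous (triadicMap r j) := fun j => by unfold triadicMap; fun_prop
  rw [distortion, hP.integral_eq h0 h1 (continuous_inf'_sq_dist β hβ)]
  have hj : ∀ j : Fin 3, ∫ x, β.inf' hβ (fun a => |triadicMap r j x - a| ^ 2) ∂P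
      ≤ r ^ 2 * distortion P α hα := by
    intro j
    rw [distortion, ← integral_const_mul]
    refine integral_mono
      (hP.integrable h0 h1 ((continuous_inf'_sq_dist β hβ).comp (hS j)))
      (hP.integrable h0 h1 ((continuous_inf'_sq_dist α hα).const_mul _)) fun x => ?_
    obtain ⟨a, ha, hae⟩ := Finset.exists_mem_eq_inf' hα (fun a => |x - a| ^ 2)
    simp only [hae]
    refine (Finset.inf'_le (fun a => |triadicMap r j x - a| ^ 2) (hmem j a ha)).trans_eq ?_
    rw [sq_abs, sq_abs]
    unfold triadicMap
    ring
  have := Finset.sum_le_sum fun j (_ : j ∈ (Finset.univ : Finset (Fin 3))) => hj j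
  rw [Finset.sum_const, Finset.card_univ, Fintype.card_fin, nsmul_eq_mul] at this
  push_cast at this
  linarith

/-- The right-hand side is the variance of the distribution. -/
theorem quantizationError_one_le (hP : IsTriadicCantorDistribution r P) (h0 : 0 < r)
    (h1 : r < 1) : quantizationError P 1 ≤ (1 - r) / (6 * (1 + r)) := by
  have := hP.isProbabilityMeasure
  refine (quantizationError_le_distortion P {1 / 2} (Finset.singleton_nonempty _) (by simp)).trans ?_
  simp only [distortion, Finset.inf'_singleton, sq_abs]
  have i1 : Integrable (fun x : ℝ => r ^ 2 * (x - 1 / 2) ^ 2) P :=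
    hP.integrable h0 h1 (by fun_prop)
  have i2 : ∀ t : ℝ, Integrable (fun x : ℝ => t * (x - 1 / 2)) P :=
    fun t => hP.integrable h0 h1 (by fun_prop)
  have key := hP.integral_eq h0 h1 (f := fun x => (x - 1 / 2) ^ 2) (by fun_prop)
  -- The cross terms of the outer two pieces cancel.
  have hsum : ∑ j : Fin 3, ∫ x, (triadicMap r j x - 1 / 2) ^ 2 ∂P
      = 3 * (r ^ 2 * ∫ x, (x - 1 / 2) ^ 2 ∂P) + (1 - r) ^ 2 / 2 := by
    have hj : ∀ j : Fin 3, ∫ x, (triadicMap r j x - 1 / 2) ^ 2 ∂P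
        = r ^ 2 * ∫ x, (x - 1 / 2) ^ 2 ∂P
          + r * (1 - r) * (((j : ℕ) : ℝ) - 1) * ∫ x, (x - 1 / 2) ∂P
          + ((((j : ℕ) : ℝ) - 1) * ((1 - r) / 2)) ^ 2 := by
      intro j
      have e : ∀ x : ℝ, (triadicMap r j x - 1 / 2) ^ 2 = r ^ 2 * (x - 1 / 2) ^ 2
          + r * (1 - r) * (((j : ℕ) : ℝ) - 1) * (x - 1 / 2)
          + ((((j : ℕ) : ℝ) - 1) * ((1 - r) / 2)) ^ 2 := fun x => by unfold triadicMap; ring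
      simp only [e]
      have i3 : Integrable (fun x : ℝ => r ^ 2 * (x - 1 / 2) ^ 2
          + r * (1 - r) * (((j : ℕ) : ℝ) - 1) * (x - 1 / 2)) P := i1.add (i2 _)
      rw [integral_add i3 (integrable_const _), integral_add i1 (i2 _), integral_const_mul, integral_const_mul, integral_const, probReal_univ, one_smul]
    simp only [hj, Fin.sum_univ_three]
    norm_num
    ring
  rw [hsum] at key
  rw [le_div_iff₀ (by linarith)]
  have h : (1 - r) * (∫ x, (x - 1 / 2) ^ 2 ∂P) * (6 * (1 + r)) = (1 - r) * (1 - r) := by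
    linear_combination 6 * key
  refine le_of_mul_le_mul_left ?_ (by linarith : 0 < 1 - r)
  linarith

end IsTriadicCantorDistribution

/-! ### The quantization sequence along geometric subsequences -/

theorem criticalRatio_lt : criticalRatio < 47 / 200 := by
  have hspec : IsCriticalRatio criticalRatio := existsUnique_isCriticalRatio.choose_spec.1
  obtain ⟨⟨h0, h1⟩, h⟩ := hspec
  generalize criticalRatio = r at h h0 h1
  have hr : r + 1 ≠ 0 := by linarith
  have hpoly : 648 - 216 * r - 13968 * r ^ 2 + 8784 * r ^ 3 + 16920 * r ^ 4 - 7848 * r ^ 5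
      - 3600 * r ^ 6 - 720 * r ^ 7 = 0 := by
    field_simp at h
    linear_combination -h
  by_contra! hge
  -- On `[47 / 200, 1 / 3)` the polynomial is at most its value at `47 / 200`, which is negative.
  have h3 : r ^ 3 - (47 / 200) ^ 3 ≤ 2 / 3 * (r ^ 2 - (47 / 200) ^ 2) := by
    have : 0 ≤ (r - 47 / 200) *
        (2 / 3 * (r + 47 / 200) - (r ^ 2 + r * (47 / 200) + (47 / 200) ^ 2)) :=
      mul_nonneg (by linarith) (by nlinarith)
    linarith
  have h4 : r ^ 4 - (47 / 200) ^ 4 ≤ 2 / 9 * (r ^ 2 - (47 / 200) ^ 2) := by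
    have : 0 ≤ (r ^ 2 - (47 / 200) ^ 2) * (2 / 9 - (r ^ 2 + (47 / 200) ^ 2)) :=
      mul_nonneg (by nlinarith) (by nlinarith)
    linarith
  have h2 : (47 / 200) ^ 2 ≤ r ^ 2 := pow_le_pow_left₀ (by norm_num) hge 2
  have h5 : (47 / 200) ^ 5 ≤ r ^ 5 := pow_le_pow_left₀ (by norm_num) hge 5
  have h6 : (47 / 200) ^ 6 ≤ r ^ 6 := pow_le_pow_left₀ (by norm_num) hge 6
  have h7 : (47 / 200) ^ 7 ≤ r ^ 7 := pow_le_pow_left₀ (by norm_num) hge 7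
  linarith

theorem three_pow_rpow {r : ℝ} (h0 : 0 < r) (h1 : r < 1) (k : ℕ) :
    ((3 : ℝ) ^ k) ^ (2 / triadicDim r) = (r ^ (2 * k))⁻¹ := by
  have hlog : Real.log r ≠ 0 := (Real.log_neg h0 h1).ne
  have h3 : Real.log 3 ≠ 0 := (Real.log_pos (by norm_num)).ne'
  rw [Real.rpow_def_of_pos (by positivity), Real.log_pow, triadicDim,
    ← Real.exp_log (by positivity : 0 < (r ^ (2 * k))⁻¹), Real.log_inv, Real.log_pow]
  congr 1
  push_cast
  field_simp

/-- Since `2 ^ 2 ≥ 3`, the factor `2 ^ (2 / β)` is at least `3 ^ (1 / β) = 1 / r`. -/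
theorem inv_le_two_rpow {r : ℝ} (h0 : 0 < r) (h1 : r < 1) :
    r⁻¹ ≤ (2 : ℝ) ^ (2 / triadicDim r) := by
  have hlog : Real.log r < 0 := Real.log_neg h0 h1
  have h3 : 0 < Real.log 3 := Real.log_pos (by norm_num)
  have h23 : Real.log 3 ≤ 2 * Real.log 2 := by
    have := Real.log_le_log (by norm_num : (0 : ℝ) < 3) (by norm_num : (3 : ℝ) ≤ 2 ^ 2)
    rwa [Real.log_pow] at this
  rw [Real.rpow_def_of_pos (by norm_num), triadicDim, ← Real.exp_log (inv_pos.2 h0), Real.log_inv]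
  refine Real.exp_le_exp.2 ?_
  have e : Real.log 2 * (2 / (-Real.log 3 / Real.log r))
      = (2 * Real.log 2 / Real.log 3) * -Real.log r := by
    field_simp
  rw [e]
  exact le_mul_of_one_le_left (by linarith) ((one_le_div h3).2 h23)

theorem quantizationSequence_mul_three_pow {r : ℝ} (h0 : 0 < r) (h1 : r < 1) (P : Measure ℝ)
    (m k : ℕ) : quantizationSequence P (triadicDim r) (m * 3 ^ k)
      = (m : ℝ) ^ (2 / triadicDim r) * ((r ^ (2 * k))⁻¹ * quantizationError P (m * 3 ^ k)) := by
  rw [quantizationSequence]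
  push_cast
  rw [Real.mul_rpow (by positivity) (by positivity), three_pow_rpow h0 h1, mul_assoc]

theorem IsTriadicCantorDistribution.antitone_quantizationSequence {r : ℝ} {P : Measure ℝ}
    (hP : IsTriadicCantorDistribution r P) (h0 : 0 < r) (h1 : r < 1) {m : ℕ} (hm : 1 ≤ m) :
    Antitone fun k : ℕ => quantizationSequence P (triadicDim r) (m * 3 ^ k) := by
  refine antitone_nat_of_succ_le fun k => ?_
  simp only [quantizationSequence_mul_three_pow h0 h1]
  refine mul_le_mul_of_nonneg_left ?_ (by positivity)
  have h := hP.quantizationError_three_mul_le h0 h1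
    (Nat.one_le_iff_ne_zero.2 (by positivity) : 1 ≤ m * 3 ^ k)
  rw [show m * 3 ^ (k + 1) = 3 * (m * 3 ^ k) by ring, inv_mul_le_iff₀ (by positivity)]
  refine h.trans_eq ?_
  rw [show 2 * (k + 1) = 2 * k + 2 by ring, pow_add]
  field_simp

theorem IsTriadicCantorDistribution.tendsto_quantizationSequence {r : ℝ} {P : Measure ℝ}
    (hP : IsTriadicCantorDistribution r P) (h0 : 0 < r) (h1 : r < 1) {m : ℕ} (hm : 1 ≤ m) :
    ∃ L : ℝ, Tendsto (fun k : ℕ => quantizationSequence P (triadicDim r) (m * 3 ^ k))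
      atTop (𝓝 L) :=
  ⟨_, tendsto_atTop_ciInf (hP.antitone_quantizationSequence h0 h1 hm)
    ⟨0, by rintro _ ⟨k, rfl⟩; exact mul_nonneg (by positivity) (quantizationError_nonneg P _)⟩⟩

theorem theorem5p2 (r : ℝ) (hr0 : 0 < r) (hr1 : r ≤ criticalRatio)
    (P : Measure ℝ) (hP : IsTriadicCantorDistribution r P) :
    (¬ ∃ L : ℝ, Tendsto (quantizationSequence P (triadicDim r)) atTop (𝓝 L)) ∧
    ∃ a b : ℝ, a ≠ b ∧
      Tendsto (fun k : ℕ => quantizationSequence P (triadicDim r) (3 ^ k)) atTop (𝓝 a) ∧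
      Tendsto (fun k : ℕ => quantizationSequence P (triadicDim r) (2 * 3 ^ k)) atTop (𝓝 b) := by
  have hr : r < 47 / 200 := hr1.trans_lt criticalRatio_lt
  have h1 : r < 1 := by linarith
  obtain ⟨a, ha⟩ := hP.tendsto_quantizationSequence hr0 h1 le_rfl
  obtain ⟨b, hb⟩ := hP.tendsto_quantizationSequence hr0 h1 one_le_two
  have hale : a ≤ (1 - r) / (6 * (1 + r)) := by
    refine le_trans ?_ (hP.quantizationError_one_le hr0 h1)
    have := (hP.antitone_quantizationSequence hr0 h1 le_rfl).le_of_tendsto ha 0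
    simpa [quantizationSequence] using this
  have hbge : r⁻¹ * ((1 - r) ^ 2 / 24) ≤ b := by
    refine ge_of_tendsto' hb fun k => ?_
    rw [quantizationSequence_mul_three_pow hr0 h1]
    refine mul_le_mul (inv_le_two_rpow hr0 h1) ?_ (by positivity) (by positivity)
    rw [le_inv_mul_iff₀ (by positivity)]
    exact hP.le_quantizationError_two_mul hr0 (by linarith) k
  -- The bound for `a` lies below the bound for `b`: this amounts to `4 r < 1 - r²`.
  have hlt : (1 - r) / (6 * (1 + r)) < r⁻¹ * ((1 - r) ^ 2 / 24) := by
    rw [inv_mul_eq_div, div_div, div_lt_div_iff₀ (by positivity) (by positivity)]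
    have : 0 < 6 * (1 - r) * (1 - r ^ 2 - 4 * r) :=
      mul_pos (by linarith) (by nlinarith)
    nlinarith
  have hab : a ≠ b := (hale.trans_lt (hlt.trans_le hbge)).ne
  simp only [one_mul] at ha
  refine ⟨?_, a, b, hab, ha, hb⟩
  rintro ⟨L, hL⟩
  have hp : Tendsto (fun k : ℕ => 3 ^ k) atTop atTop :=
    tendsto_pow_atTop_atTop_of_one_lt (by norm_num : 1 < 3)
  have haL := tendsto_nhds_unique ha (hL.comp hp)
  have hbL := tendsto_nhds_unique hb (hL.comp (hp.const_mul_atTop' two_pos))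
  exact hab (haL.trans hbL.symm)
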